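/- (a) Let $\alpha$ be an algebraic integer, $K=\mathbb{Q}(\alpha)$, $A=\mathbb{Z}[\alpha]$. Let $\overline{A}$ be the integral closure of $A$ in $K$ and let $A^{\dagger}=\{x\in K : \mathrm{Tr}_{K/\mathbb{Q}}(xA)\subseteq \mathbb{Z}\}$ be its trace dual. Let $p$ be a prime number with $p>[K:\mathbb{Q}]$. Then $p$ divides the exponent of the group $\overline{A}/A$ if and only if $p^2$ divides the exponent of the group $A^{\dagger}/A$. (b) More generally, let $R$ be a Dedekind domain with fraction field $F$, and let $A$ be an order over $R$, that is, a commutative $R$-algebra that is finitely generated and torsion-free as an $R$-module and whose total quotient ring $Q(A)=A\otimes_R F$ is finite étale over $F$ (equivalently, the trace form $(x,y)\mapsto \mathrm{Tr}_{Q(A)/F}(xy)$ is non-degenerate). Let $\overline{A}$ be the integral closure of $A$ in $Q(A)$ and $A^{\dagger}=\{x\in Q(A) : \mathrm{Tr}_{Q(A)/F}(xA)\subseteq R\}$. Let $\mathfrak{p}$ be a nonzero prime ideal of $R$ such that $\mathrm{char}(R/\mathfrak{p})=0$ or $\mathrm{char}(R/\mathfrak{p})>\dim_F Q(A)$. Then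 $\mathfrak{p}$ divides the annihilator ideal $\mathrm{Ann}_R(\overline{A}/A)$ if and only if $\mathfrak{p}^2$ divides $\mathrm{Ann}_R(A^{\dagger}/A)$. -/

import Mathlib

/-! Orders over Dedekind domains. Throughout, `F` is the fraction field of `R`, and `Q` is the
total quotient ring of `A`, which is an algebra over `F`. -/

/-- `A` is an order over `R`: it is finitely generated and torsion-free as an `R`-module, and its
total quotient ring `Q` is finite étale over `F`, that is, the trace form
`(x, y) ↦ Tr_{Q/F}(x y)` is non-degenerate. (Finiteness of `Q` over `F` follows from that of `A`
over `R`.) -/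
structure IsTraceOrder (R F A Q : Type*) [CommRing R] [Field F] [CommRing A] [CommRing Q]
    [Algebra R A] [Algebra F Q] : Prop where
  finite : Module.Finite R A
  torsionFree : Module.IsTorsionFree R A
  etale : (Algebra.traceForm F Q).Nondegenerate

/-- The image of `A` in `Q`, as an `R`-submodule of `Q`. -/
def orderSubmodule (R A Q : Type*) [CommRing R] [CommRing A] [CommRing Q]
    [Algebra R A] [Algebra A Q] [Algebra R Q] [IsScalarTower R A Q] : Submodule R Q :=
  LinearMap.range (IsScalarTower.toAlgHom R A Q).toLinearMap

/-- The integral closure `Ā` of `A` in `Q`, as an `R`-submodule of `Q`. -/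
def closureSubmodule (R A Q : Type*) [CommRing R] [CommRing A] [CommRing Q]
    [Algebra R A] [Algebra A Q] [Algebra R Q] [IsScalarTower R A Q] : Submodule R Q :=
  (Subalgebra.toSubmodule (integralClosure A Q)).restrictScalars R

/-- The trace dual `A† = {x ∈ Q : Tr_{Q/F}(x A) ⊆ R}`, as an `R`-submodule of `Q`. -/
noncomputable def traceDualSubmodule (R F A Q : Type*) [CommRing R] [Field F] [CommRing A] [CommRing Q]
    [Algebra R A] [Algebra A Q] [Algebra R Q] [IsScalarTower R A Q]
    [Algebra R F] [Algebra F Q] [IsScalarTower R F Q] : Submodule R Q :=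
  (Algebra.traceForm F Q).dualSubmodule (orderSubmodule R A Q)

/-- The `R`-module `Ā/A`. -/
abbrev ClosureQuotient (R A Q : Type*) [CommRing R] [CommRing A] [CommRing Q]
    [Algebra R A] [Algebra A Q] [Algebra R Q] [IsScalarTower R A Q] : Type _ :=
  closureSubmodule R A Q ⧸ (orderSubmodule R A Q).submoduleOf (closureSubmodule R A Q)

/-- The `R`-module `A†/A`. -/
abbrev DualQuotient (R F A Q : Type*) [CommRing R] [Field F] [CommRing A] [CommRing Q]
    [Algebra R A] [Algebra A Q] [Algebra R Q] [IsScalarTower R A Q]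
    [Algebra R F] [Algebra F Q] [IsScalarTower R F Q] : Type _ :=
  traceDualSubmodule R F A Q ⧸ (orderSubmodule R A Q).submoduleOf (traceDualSubmodule R F A Q)

/-!
Let `J` be the radical of `P A`. Modulo `P` the trace form of `A` becomes that of `A / P A`, whose
kernel is the nilradical because the assumption on the characteristic gives every nonzero
idempotent of `A / P A` a nonzero trace; hence `P A† ∩ A = J`. Working locally at `P`, where `P` is
principal, the claim becomes that `Ā ⊆ A` if and only if `P A† ⊆ A`.

For `M = P A†` and for `M = Ā` one has `J M ∩ A ⊆ J`, and `J ^ n M ⊆ A` for some `n`. If the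
multiplier ring `(J : J)` equals `A`, then `n` can be lowered step by step to `0`, so `M ⊆ A`. When
`Ā ⊆ A`, this applies because `(J : J) ⊆ Ā`. When `P A† ⊆ A`, it applies because `P A† = J`, so that
`(J : J) = (A† : A†) = A`.
-/

/-- A finite system of projective coordinates on an `R`-module `M`: vectors and linear forms with
`x = ∑ i, coord i x • vec i`. It does for a finitely generated projective module what a basis and
its dual basis do for a free one. -/
structure ProjectiveCoordinates (R M ι : Type*) [CommRing R] [AddCommGroup M] [Module R M]
    [Fintype ι] where
  vec : ι → M
  coord : ι → Module.Dual R M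
  sum_coord_smul : ∀ x, ∑ i, coord i x • vec i = x

namespace ProjectiveCoordinates

theorem exists_of_projective (R M : Type*) [CommRing R] [AddCommGroup M] [Module R M]
    [Module.Finite R M] [Module.Projective R M] :
    ∃ n, Nonempty (ProjectiveCoordinates R M (Fin n)) := by
  obtain ⟨n, f, g, -, -, hfg⟩ := Module.Finite.exists_comp_eq_id_of_projective R M
  refine ⟨n, ⟨fun i ↦ f (Pi.single i 1), fun i ↦ LinearMap.proj i ∘ₗ g, fun x ↦ ?_⟩⟩
  calc ∑ i, g x i • f (Pi.single i 1)
      = f (g x) := by conv_rhs => rw [pi_eq_sum_univ' (g x), map_sum]; simp only [map_smul]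
    _ = x := LinearMap.congr_fun hfg x

section
variable {R M ι : Type*} [CommRing R] [AddCommGroup M] [Module R M] [Fintype ι]

/-- The trace of an endomorphism in projective coordinates; it does not depend on the coordinates,
and commutes with base change. -/
def trace (c : ProjectiveCoordinates R M ι) (φ : Module.End R M) : R :=
  ∑ i, c.coord i (φ (c.vec i))

theorem linearMapTrace_eq (c : ProjectiveCoordinates R M ι) [Module.Free R M] [Module.Finite R M]
    (φ : Module.End R M) : LinearMap.trace R M φ = c.trace φ := by
  have hφ : φ = ∑ i, dualTensorHom R M M (c.coord i ⊗ₜ φ (c.vec i)) := by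
    ext x
    conv_lhs => rw [← c.sum_coord_smul x]
    simp
  conv_lhs => rw [hφ]
  simp [trace, LinearMap.trace_eq_contract_apply]

variable {S V : Type*} [CommRing S] [Algebra R S] [AddCommGroup V] [Module R V]
  [Module S V] [IsScalarTower R S V] {ε : M →ₗ[R] V}

/-- The coordinates induced on a base change. -/
noncomputable def baseChange (c : ProjectiveCoordinates R M ι) (hε : IsBaseChange S ε) :
    ProjectiveCoordinates S V ι where
  vec i := ε (c.vec i)
  coord i := hε.toDual (c.coord i)
  sum_coord_smul v := by
    have : ∑ i, (hε.toDual (c.coord i)).smulRight (ε (c.vec i)) = LinearMap.id :=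
      hε.algHom_ext _ _ fun x ↦ by
        conv_rhs => rw [← c.sum_coord_smul x]
        simp [hε.toDual_comp_apply]
    simpa using LinearMap.congr_fun this v

theorem linearMapTrace_eq_algebraMap (c : ProjectiveCoordinates R M ι) (hε : IsBaseChange S ε)
    [Module.Free S V] [Module.Finite S V] {φ : Module.End R M} {ψ : Module.End S V}
    (h : ∀ x, ψ (ε x) = ε (φ x)) : LinearMap.trace S V ψ = algebraMap R S (c.trace φ) := by
  simp [(c.baseChange hε).linearMapTrace_eq ψ, trace, baseChange, h, hε.toDual_comp_apply]

end
end ProjectiveCoordinates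

theorem isBaseChange_quotient_map {R : Type*} (A : Type*) [CommRing R] [CommRing A] [Algebra R A]
    (I : Ideal R) :
    IsBaseChange (R ⧸ I) (IsScalarTower.toAlgHom R A (A ⧸ I.map (algebraMap R A))).toLinearMap :=
  .of_equiv (Algebra.TensorProduct.quotIdealMapEquivQuotTensor A I).symm.toLinearEquiv fun x ↦
    (Algebra.TensorProduct.quotIdealMapEquivQuotTensor A I).symm_apply_apply (Ideal.Quotient.mk _ x)

theorem finrank_eq_of_isBaseChange {R M k V : Type*} [CommRing R] [IsDomain R] [AddCommGroup M]
    [Module R M] [Module.Finite R M] [Module.Flat R M] [Field k] [Algebra R k] [AddCommGroup V]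
    [Module R V] [Module k V] [IsScalarTower R k V] {ε : M →ₗ[R] V} (hε : IsBaseChange k ε) :
    Module.finrank k V = Module.finrank R M := by
  let p : PrimeSpectrum k := ⊥
  let q := PrimeSpectrum.comap (algebraMap R k) p
  calc Module.finrank k V
      = Module.rankAtStalk V p := by rw [Module.rankAtStalk_eq_finrank_of_free]; rfl
    _ = Module.rankAtStalk M q := Module.rankAtStalk_isBaseChange hε p
    _ = Module.finrank q.asIdeal.ResidueField (q.asIdeal.Fiber M) := Module.rankAtStalk_eq q
    _ = Module.finrank R M := q.asIdeal.finrank_fiber_eq_finrank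

theorem exists_isIdempotentElem_mul_of_isArtinianRing {B : Type*} [CommRing B] [IsArtinianRing B]
    (x : B) : ∃ n z, IsIdempotentElem (x * z) ∧ x ^ n * (x * z) = x ^ n := by
  obtain ⟨n, y, hy⟩ := IsArtinian.exists_pow_succ_smul_dvd x (1 : B)
  simp only [smul_eq_mul, mul_one, Nat.succ_eq_add_one] at hy
  have absorb (m : ℕ) : x ^ n * (x * y) ^ m = x ^ n := by
    induction m with
    | zero => rw [pow_zero, mul_one]
    | succ m ih => rw [pow_succ, ← mul_assoc, ih, ← mul_assoc, ← pow_succ, hy]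
  have hz : x * (x ^ n * y ^ (n + 1)) = (x * y) ^ (n + 1) := by ring
  refine ⟨n, x ^ n * y ^ (n + 1), ?_, ?_⟩
  · calc x * (x ^ n * y ^ (n + 1)) * (x * (x ^ n * y ^ (n + 1)))
        = x * y ^ (n + 1) * (x ^ n * (x * y) ^ (n + 1)) := by ring
      _ = x * (x ^ n * y ^ (n + 1)) := by rw [absorb]; ring
  · rw [hz, absorb]

theorem eq_zero_of_isIdempotentElem_of_trace_eq_zero {k V : Type*} [Field k]
    [AddCommGroup V] [Module k V] [FiniteDimensional k V]
    (hk : ringChar k = 0 ∨ Module.finrank k V < ringChar k) {e : Module.End k V}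
    (he : IsIdempotentElem e) (htr : LinearMap.trace k V e = 0) : e = 0 := by
  have hrank : ringChar k ∣ Module.finrank k (LinearMap.range e) := by
    rw [← ringChar.spec, ← (LinearMap.IsIdempotentElem.isProj_range e he).trace, htr]
  suffices Module.finrank k (LinearMap.range e) = 0 from
    LinearMap.range_eq_bot.mp (Submodule.finrank_eq_zero.mp this)
  obtain hk | hk := hk
  · rwa [hk, zero_dvd_iff] at hrank
  · exact Nat.eq_zero_of_dvd_of_lt hrank ((Submodule.finrank_le _).trans_lt hk)

theorem isNilpotent_iff_forall_trace_mul_eq_zero {k B : Type*} [Field k] [CommRing B] [Algebra k B]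
    [FiniteDimensional k B] (hk : ringChar k = 0 ∨ Module.finrank k B < ringChar k) {x : B} :
    IsNilpotent x ↔ ∀ b, Algebra.trace k B (x * b) = 0 := by
  refine ⟨fun hx b ↦ (Algebra.isNilpotent_trace_of_isNilpotent
    (Commute.isNilpotent_mul_right (Commute.all _ _) hx)).eq_zero, fun hx ↦ ?_⟩
  have : IsArtinianRing B := IsArtinianRing.of_finite k B
  obtain ⟨n, z, he, hz⟩ := exists_isIdempotentElem_mul_of_isArtinianRing x
  have hmul : Algebra.lmul k B (x * z) = 0 :=
    eq_zero_of_isIdempotentElem_of_trace_eq_zero hk (he.map _) (hx z)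
  have hxz : x * z = 0 := by simpa using LinearMap.congr_fun hmul 1
  exact ⟨n, by rw [← hz, hxz, mul_zero]⟩

/-- The trace of `A` reduces modulo `P` to the trace of `A / PA`, for which the elements in the
kernel of the trace form are nilpotent by the assumption on the characteristic. -/
theorem ProjectiveCoordinates.mem_radical_map_iff {R A ι : Type*} [CommRing R] [IsDomain R]
    [CommRing A] [Algebra R A] [Module.Finite R A] [Module.Flat R A] [Fintype ι]
    (c : ProjectiveCoordinates R A ι) {P : Ideal R} [P.IsMaximal]
    (hP : ringChar (R ⧸ P) = 0 ∨ Module.finrank R A < ringChar (R ⧸ P)) {x : A} :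
    x ∈ (P.map (algebraMap R A)).radical ↔ ∀ a, c.trace (Algebra.lmul R A (x * a)) ∈ P := by
  let := Ideal.Quotient.field P
  let π := Ideal.Quotient.mk (P.map (algebraMap R A))
  have hB := isBaseChange_quotient_map A P
  have : Module.Finite (R ⧸ P) (A ⧸ P.map (algebraMap R A)) := .of_restrictScalars_finite R _ _
  have htrace (b : A) : Algebra.trace (R ⧸ P) (A ⧸ P.map (algebraMap R A)) (π b) =
      Ideal.Quotient.mk P (c.trace (Algebra.lmul R A b)) :=
    c.linearMapTrace_eq_algebraMap hB fun y ↦ (map_mul π b y).symm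
  rw [← finrank_eq_of_isBaseChange hB] at hP
  calc x ∈ (P.map (algebraMap R A)).radical
      ↔ IsNilpotent (π x) := by
        simp only [Ideal.mem_radical_iff, IsNilpotent, ← map_pow, π, Ideal.Quotient.eq_zero_iff_mem]
    _ ↔ ∀ a, Algebra.trace (R ⧸ P) (A ⧸ P.map (algebraMap R A)) (π x * π a) = 0 := by
        rw [isNilpotent_iff_forall_trace_mul_eq_zero hP, Ideal.Quotient.mk_surjective.forall]
    _ ↔ ∀ a, c.trace (Algebra.lmul R A (x * a)) ∈ P := by
        simp only [← map_mul π, htrace, Ideal.Quotient.eq_zero_iff_mem]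

open IsLocalization (coeSubmodule)
open scoped Pointwise nonZeroDivisors

section DedekindPrime
variable {R : Type*} [CommRing R] [IsDedekindDomain R] {P : Ideal R}

theorem exists_notMem_pow_dvd [hP : P.IsPrime] (hP0 : P ≠ ⊥) {r : R} (hr : r ≠ 0) :
    ∃ e, r ∈ P ^ e ∧ ∃ s ∉ P, ∀ x ∈ P ^ e, r ∣ s * x := by
  have hr' : Ideal.span {r} ≠ 0 := by simpa using hr
  obtain ⟨C, hC, hdvd⟩ := (FiniteMultiplicity.of_prime_left (Ideal.prime_of_isPrime hP0 hP)
    hr').exists_eq_pow_mul_and_not_dvd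
  rw [Ideal.dvd_iff_le, SetLike.not_le_iff_exists] at hdvd
  obtain ⟨s, hsC, hsP⟩ := hdvd
  refine ⟨multiplicity P (Ideal.span {r}), ?_, s, hsP, fun x hx ↦ ?_⟩
  · exact Ideal.mul_le_left (hC ▸ Ideal.mem_span_singleton_self r)
  · rw [← Ideal.mem_span_singleton, hC, mul_comm s x]
    exact Ideal.mul_mem_mul hx hsC

theorem exists_notMem_dvd_of_notMem_sq [P.IsPrime] (hP0 : P ≠ ⊥) {t : R} (ht : t ∉ P ^ 2) :
    ∃ s ∉ P, ∀ x ∈ P, t ∣ s * x := by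
  obtain ⟨e, hte, s, hs, h⟩ := exists_notMem_pow_dvd hP0 (r := t) fun h0 ↦ ht (h0 ▸ zero_mem _)
  have he : e ≤ 1 := by
    by_contra! he
    exact ht (Ideal.pow_le_pow_right he hte)
  exact ⟨s, hs, fun x hx ↦ h x (Ideal.pow_le_pow_right he (by simpa using hx))⟩

theorem exists_mem_notMem_sq [P.IsPrime] (hP0 : P ≠ ⊥) : ∃ t ∈ P, t ∉ P ^ 2 :=
  SetLike.exists_of_lt (by simpa using Ideal.pow_succ_lt_pow hP0 1)

end DedekindPrime

section LocallyLE
variable {R A Q : Type*} [CommRing R] [CommRing A] [CommRing Q] [Algebra A Q]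
  [Algebra R Q] {P : Ideal R} {J L M N : Submodule A Q}

/-- `M` is contained in `N` locally at the prime `P` of `R`, in the sense that a single
denominator outside `P` works for all of `M`. When `M` is finitely generated this says that the
localization of `M` at `P` is contained in that of `N`. -/
def LocallyLE (P : Ideal R) (M N : Submodule A Q) : Prop :=
  ∃ s ∉ P, ∀ x ∈ M, s • x ∈ N

namespace LocallyLE

theorem of_le [P.IsPrime] (h : M ≤ N) : LocallyLE P M N :=
  ⟨1, (Ideal.ne_top_iff_one P).mp Ideal.IsPrime.ne_top', fun x hx ↦ by simpa using h hx⟩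

theorem trans [P.IsPrime] (h₁ : LocallyLE P L M) (h₂ : LocallyLE P M N) : LocallyLE P L N := by
  obtain ⟨s, hs, h₁⟩ := h₁
  obtain ⟨t, ht, h₂⟩ := h₂
  exact ⟨t * s, ‹P.IsPrime›.mul_notMem ht hs, fun x hx ↦ by
    rw [mul_smul]; exact h₂ _ (h₁ x hx)⟩

theorem mono_left (h : LocallyLE P M N) (hL : L ≤ M) : LocallyLE P L N :=
  h.imp fun _ hs ↦ ⟨hs.1, fun x hx ↦ hs.2 x (hL hx)⟩

theorem mono_right (h : LocallyLE P L M) (hN : M ≤ N) : LocallyLE P L N :=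
  h.imp fun _ hs ↦ ⟨hs.1, fun x hx ↦ hN (hs.2 x hx)⟩

theorem mul_left_iff_le_div : LocallyLE P (L * M) N ↔ LocallyLE P L (N / M) := by
  refine exists_congr fun s ↦ and_congr_right fun _ ↦ ?_
  simp only [Submodule.mem_div_iff_forall_mul_mem, smul_mul_assoc]
  refine ⟨fun h x hx y hy ↦ h _ (Submodule.mul_mem_mul hx hy), fun h x hx ↦ ?_⟩
  induction hx using Submodule.mul_induction_on' with
  | mem_mul_mem x hx y hy => exact h x hx y hy
  | add x _ y _ hx hy => rw [smul_add]; exact add_mem hx hy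

theorem mul_left (L : Submodule A Q) (h : LocallyLE P M N) : LocallyLE P (L * M) (L * N) := by
  obtain ⟨s, hs, h⟩ := h
  rw [mul_comm L M, mul_left_iff_le_div]
  refine ⟨s, hs, fun x hx ↦ Submodule.mem_div_iff_forall_mul_mem.mpr fun y hy ↦ ?_⟩
  exact mul_comm y (s • x) ▸ Submodule.mul_mem_mul hy (h x hx)

variable [Algebra R A] [IsScalarTower R A Q]

theorem inf_of_le (h : LocallyLE P L M) (hN : L ≤ N) : LocallyLE P L (N ⊓ M) :=
  h.imp fun s hs ↦ ⟨hs.1, fun x hx ↦ ⟨N.smul_of_tower_mem s (hN hx), hs.2 x hx⟩⟩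

/-- If `J ^ (n + 1) * M` is contained in `A` locally at `P`, then `J ^ n * M` multiplies `J` into
`J` there, and hence is contained in `A` as well. -/
theorem of_pow_mul [P.IsPrime] (hJ : J ≤ 1) (hJM : J * M ⊓ 1 ≤ J) (hdiv : LocallyLE P (J / J) 1)
    {n : ℕ} (h : LocallyLE P (J ^ n * M) 1) : LocallyLE P M 1 := by
  induction n with
  | zero => simpa using h
  | succ n ih =>
    have hle : J ^ (n + 1) * M ≤ J * M := by
      rw [pow_succ', mul_assoc]
      exact mul_le_mul_right (mul_le_of_le_one_left' (pow_le_one' hJ n)) J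
    refine ih (trans (mul_left_iff_le_div.mp ?_) hdiv)
    rw [mul_right_comm, ← pow_succ]
    exact (h.inf_of_le hle).mono_right hJM

end LocallyLE
end LocallyLE

section IdealExtension
variable {R : Type*} (A Q : Type*) [CommRing R] [CommRing A] [CommRing Q] [Algebra R A]
  [Algebra A Q]

/-- The extension `I A ⊆ Q` of an ideal `I` of `R`, as an `A`-submodule of `Q`. -/
def idealExtension (I : Ideal R) : Submodule A Q :=
  coeSubmodule Q (I.map (algebraMap R A))

variable {A Q}

theorem idealExtension_pow (I : Ideal R) (n : ℕ) :
    idealExtension A Q (I ^ n) = idealExtension A Q I ^ n := by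
  rw [idealExtension, Ideal.map_pow]
  exact map_pow (Submodule.mapHom (Algebra.ofId A Q)) _ n

variable [Algebra R Q] [IsScalarTower R A Q] {P I : Ideal R} {M N : Submodule A Q}

theorem idealExtension_mul_le :
    idealExtension A Q I * M ≤ N ↔ ∀ r ∈ I, ∀ x ∈ M, r • x ∈ N := by
  rw [← Submodule.le_div_iff_mul_le, idealExtension, Ideal.map, IsLocalization.coeSubmodule_span,
    Submodule.span_le]
  simp only [← Set.image_comp, Set.subset_def, Set.forall_mem_image, Function.comp_apply,
    SetLike.mem_coe, Submodule.mem_div_iff_forall_mul_mem, Algebra.smul_def,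
    ← IsScalarTower.algebraMap_apply]

theorem smul_mem_idealExtension_mul {r : R} (hr : r ∈ I) {x : Q} (hx : x ∈ M) :
    r • x ∈ idealExtension A Q I * M :=
  idealExtension_mul_le.mp le_rfl r hr x hx

theorem LocallyLE.idealExtension_mul {r : R} (h : ∃ s ∉ P, ∀ x ∈ I, r ∣ s * x) :
    LocallyLE P (idealExtension A Q I * M) (r • M) := by
  obtain ⟨s, hs, hdvd⟩ := h
  suffices idealExtension A Q I * M ≤ (r • M).comap (DistribSMul.toLinearMap A Q s) from
    ⟨s, hs, this⟩
  refine idealExtension_mul_le.mpr fun p hp x hx ↦ ?_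
  obtain ⟨t, ht⟩ := hdvd p hp
  rw [Submodule.mem_comap, DistribSMul.toLinearMap_apply, smul_smul, ht, mul_smul]
  exact Submodule.smul_mem_pointwise_smul _ r M (M.smul_of_tower_mem t hx)

variable [IsDedekindDomain R]

theorem LocallyLE.of_idealExtension_mul [Module.IsTorsionFree R Q] [P.IsPrime] (hP0 : P ≠ ⊥)
    (h : LocallyLE P (idealExtension A Q P * M) (idealExtension A Q P * N)) :
    LocallyLE P M N := by
  obtain ⟨t, htP, ht⟩ := exists_mem_notMem_sq hP0
  have ht0 : t ≠ 0 := fun h0 ↦ ht (h0 ▸ zero_mem _)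
  obtain ⟨s, hs, hMN⟩ := h.trans (.idealExtension_mul (exists_notMem_dvd_of_notMem_sq hP0 ht))
  refine ⟨s, hs, fun x hx ↦ ?_⟩
  have htx : t • s • x ∈ t • N := smul_comm s t x ▸ hMN _ (smul_mem_idealExtension_mul htP hx)
  obtain ⟨y, hy, hxy⟩ := htx
  exact smul_right_injective Q ht0 hxy ▸ hy

end IdealExtension

section IntegralClosure
variable {A Q : Type*} [CommRing A] [CommRing Q] [Algebra A Q]

theorem coeSubmodule_le_one (I : Ideal A) : coeSubmodule Q I ≤ 1 :=
  IsLocalization.coeSubmodule_top Q (R := A) ▸ IsLocalization.coeSubmodule_mono Q le_top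

theorem div_self_le_integralClosure [IsNoetherianRing A] {N : Submodule A Q} (hN : N.FG) {u : Q}
    (hu : u ∈ N) (hreg : IsRegular u) : N / N ≤ Subalgebra.toSubmodule (integralClosure A Q) := by
  have hfg : (N / N).FG := by
    refine Submodule.fg_of_fg_map_injective (LinearMap.mulRight A u) hreg.right (hN.of_le ?_)
    exact Submodule.map_le_iff_le_comap.mpr fun y hy ↦
      Submodule.mem_div_iff_forall_mul_mem.mp hy u hu
  let S := (N / N).toSubalgebra (Submodule.one_mem_div.mpr le_rfl) fun x y hx hy ↦
    Submodule.mem_div_iff_forall_mul_mem.mpr fun n hn ↦ by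
      rw [mul_assoc]
      exact Submodule.mem_div_iff_forall_mul_mem.mp hx _
        (Submodule.mem_div_iff_forall_mul_mem.mp hy n hn)
  exact fun y hy ↦ IsIntegral.of_mem_of_fg S hfg y hy

theorem comap_map_le_radical_of_isIntegral {B : Type*} [CommRing B] [Algebra A B]
    [Algebra.IsIntegral A B] (hAB : Function.Injective (algebraMap A B)) (I : Ideal A) :
    (I.map (algebraMap A B)).comap (algebraMap A B) ≤ I.radical := by
  rw [Ideal.radical_eq_sInf]
  rintro a ha
  refine Ideal.mem_sInf.mpr fun q ⟨hIq, hq⟩ ↦ ?_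
  have hker : (⊥ : Ideal B).comap (algebraMap A B) ≤ q := by
    rw [Ideal.comap_bot_of_injective _ hAB]
    exact bot_le
  obtain ⟨q', -, -, rfl⟩ := Ideal.exists_ideal_over_prime_of_isIntegral q ⊥ hker
  exact Ideal.map_le_iff_le_comap.mpr hIq ha

theorem coeSubmodule_mul_integralClosure_inf_one_le (hAQ : Function.Injective (algebraMap A Q))
    (I : Ideal A) :
    coeSubmodule Q I * Subalgebra.toSubmodule (integralClosure A Q) ⊓ 1 ≤
      coeSubmodule Q I.radical := by
  let C := integralClosure A Q
  have hmul : coeSubmodule Q I * Subalgebra.toSubmodule C ≤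
      ((I.map (algebraMap A C)).restrictScalars A).map C.val.toLinearMap := by
    rw [Submodule.mul_le]
    rintro _ ⟨i, hi, rfl⟩ c hc
    exact ⟨algebraMap A C i * ⟨c, hc⟩, Ideal.mul_mem_right _ _ (Ideal.mem_map_of_mem _ hi), rfl⟩
  rintro _ ⟨hx, hx1⟩
  obtain ⟨a, rfl⟩ := Submodule.mem_one.mp hx1
  obtain ⟨c, hc, hca⟩ := hmul hx
  obtain rfl : c = algebraMap A C a := Subtype.ext hca
  have hAC : Function.Injective (algebraMap A C) := .of_comp (f := C.val) hAQ
  exact ⟨a, comap_map_le_radical_of_isIntegral hAC I hc, rfl⟩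

end IntegralClosure

section Lattice
variable {R F V Q : Type*} [CommRing R] [Field F] [Algebra R F] [IsFractionRing R F]

theorem projective_of_finite_of_isTorsionFree (R M : Type*) [CommRing R] [IsDedekindDomain R]
    [AddCommGroup M] [Module R M] [Module.Finite R M] [Module.IsTorsionFree R M] :
    Module.Projective R M :=
  have := Module.finitePresentation_of_finite R M
  Module.Flat.projective_of_finitePresentation

variable (F) in
theorem isLocalizedModule_subtype_of_span_eq_top [AddCommGroup V] [Module R V] [Module F V]
    [IsScalarTower R F V] (N : Submodule R V) (hN : Submodule.span F (N : Set V) = ⊤) :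
    IsLocalizedModule R⁰ N.subtype where
  map_units r := by
    have hr : IsUnit (algebraMap F (Module.End F V) (algebraMap R F r)) :=
      (IsLocalization.map_units F r).map _
    rw [Module.End.isUnit_iff] at hr ⊢
    simpa [Function.Bijective, Function.Injective, Function.Surjective] using hr
  surj v := by
    obtain ⟨r, hr⟩ := multiple_mem_span_of_mem_localization_span R⁰ F (N : Set V) v
      (hN ▸ Submodule.mem_top)
    rw [Submodule.span_eq] at hr
    exact ⟨(⟨r • v, hr⟩, r), rfl⟩
  exists_of_eq h := ⟨1, by simpa using h⟩

variable [IsDedekindDomain R]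

theorem trace_mem_range_algebraMap_of_fg [AddCommGroup V] [Module R V] [Module F V]
    [IsScalarTower R F V] [FiniteDimensional F V] {N : Submodule R V} (hfg : N.FG)
    (hspan : Submodule.span F (N : Set V) = ⊤) {ψ : Module.End F V} (hψ : ∀ x ∈ N, ψ x ∈ N) :
    LinearMap.trace F V ψ ∈ (algebraMap R F).range := by
  have : Module.Finite R N := .of_fg hfg
  have : Module.IsTorsionFree R V := .trans_faithfulSMul R F V
  have := projective_of_finite_of_isTorsionFree R N
  have := isLocalizedModule_subtype_of_span_eq_top F N hspan
  obtain ⟨n, ⟨c⟩⟩ := ProjectiveCoordinates.exists_of_projective R N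
  exact ⟨_, (c.linearMapTrace_eq_algebraMap (IsLocalizedModule.isBaseChange R⁰ F N.subtype)
    (φ := (ψ.restrictScalars R).restrict hψ) fun _ ↦ rfl).symm⟩

theorem trace_mem_range_algebraMap_of_isIntegral [CommRing Q] [Algebra R Q] [Algebra F Q]
    [IsScalarTower R F Q] [FiniteDimensional F Q] {x : Q} (hx : IsIntegral R x) :
    Algebra.trace F Q x ∈ (algebraMap R F).range := by
  let b := Module.finBasis F Q
  let S := Subalgebra.toSubmodule (Algebra.adjoin R {x})
  let N := S * Submodule.span R (Set.range b)
  have hbN : Set.range b ⊆ N := fun v hv ↦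
    one_mul v ▸ Submodule.mul_mem_mul (one_mem (Algebra.adjoin R {x})) (Submodule.subset_span hv)
  refine trace_mem_range_algebraMap_of_fg (N := N)
    (hx.fg_adjoin_singleton.mul (Submodule.fg_span (Set.finite_range b)))
    (top_unique (b.span_eq ▸ Submodule.span_mono hbN)) fun v hv ↦ ?_
  have hxN : S * N ≤ N := by
    rw [← mul_assoc, (Subalgebra.isIdempotentElem_toSubmodule _).eq]
  exact hxN (Submodule.mul_mem_mul (Algebra.self_mem_adjoin_singleton R x) hv)

end Lattice

section TotalQuotientRing
variable (R F A Q : Type*) [CommRing R] [IsDomain R] [CommRing A] [CommRing Q]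
  [Algebra R A] [Algebra A Q] [IsFractionRing A Q] [Module.Finite R A] [Module.IsTorsionFree R A]

theorem isLocalization_algebraMapSubmonoid_of_finite :
    IsLocalization (Algebra.algebraMapSubmonoid A R⁰) Q := by
  refine (IsLocalization.iff_of_le_of_exists_dvd _ A⁰ ?_ ?_).mpr inferInstance
  · rintro _ ⟨r, hr, rfl⟩
    rw [mem_nonZeroDivisors_iff_right]
    intro x hx
    have h : r • x = 0 := by rw [Algebra.smul_def, mul_comm]; exact hx
    exact (smul_eq_zero_iff_right (nonZeroDivisors.ne_zero hr)).mp h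
  · intro s hs
    obtain ⟨r, hr, h⟩ :=
      (Algebra.IsIntegral.isIntegral (R := R) s).isAlgebraic.exists_nonzero_dvd hs
    exact ⟨_, ⟨r, mem_nonZeroDivisors_of_ne_zero hr, rfl⟩, h⟩

variable [Algebra R Q] [IsScalarTower R A Q]

theorem isLocalizedModule_of_finite :
    IsLocalizedModule R⁰ (IsScalarTower.toAlgHom R A Q).toLinearMap :=
  isLocalizedModule_iff_isLocalization.mpr (isLocalization_algebraMapSubmonoid_of_finite R A Q)

variable [Field F] [Algebra R F] [IsFractionRing R F] [Algebra F Q] [IsScalarTower R F Q]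

theorem isBaseChange_of_finite : IsBaseChange F (IsScalarTower.toAlgHom R A Q).toLinearMap :=
  have := isLocalizedModule_of_finite R A Q
  IsLocalizedModule.isBaseChange R⁰ F _

include R A in
theorem finiteDimensional_of_finite : FiniteDimensional F Q :=
  have := isLocalizedModule_of_finite R A Q
  Module.Finite.of_isLocalizedModule (Rₚ := F) R⁰ (IsScalarTower.toAlgHom R A Q).toLinearMap

end TotalQuotientRing

section TraceColon
variable {R F A Q : Type*} [CommRing R] [Field F] [CommRing A] [CommRing Q]
  [Algebra R F] [Algebra A Q] [Algebra F Q] {I : Ideal R}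

variable (F A Q) in
/-- The `A`-submodule `{x ∈ Q : Tr_{Q/F}(x A) ⊆ I}` of `Q`, for an ideal `I` of `R`. For `I = R` it
is the trace dual `A†`. -/
noncomputable def traceColon (I : Ideal R) : Submodule A Q where
  carrier := {x | ∀ a : A, Algebra.trace F Q (x * algebraMap A Q a) ∈ coeSubmodule F I}
  add_mem' hx hy a := by simpa only [add_mul, map_add] using add_mem (hx a) (hy a)
  zero_mem' a := by simp only [zero_mul, map_zero, zero_mem]
  smul_mem' b x hx a := by
    simpa only [Algebra.smul_def, map_mul, mul_assoc, mul_left_comm] using hx (b * a)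

theorem mem_traceColon {x : Q} : x ∈ traceColon F A Q I ↔
    ∀ a : A, Algebra.trace F Q (x * algebraMap A Q a) ∈ coeSubmodule F I :=
  Iff.rfl

theorem trace_mem_of_mem_traceColon {x : Q} (hx : x ∈ traceColon F A Q I) :
    Algebra.trace F Q x ∈ coeSubmodule F I := by
  simpa only [map_one, mul_one] using hx 1

variable [IsDedekindDomain R] [IsFractionRing R F] [Algebra R A] [IsFractionRing A Q] [Algebra R Q]
  [IsScalarTower R A Q] [IsScalarTower R F Q]

namespace IsTraceOrder

theorem exists_dual_family (h : IsTraceOrder R F A Q) :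
    ∃ (n : ℕ) (a : Fin n → A) (y : Fin n → Q),
      (∀ i, y i ∈ traceColon F A Q (⊤ : Ideal R)) ∧
      (∀ q, ∑ i, Algebra.trace F Q (y i * q) • algebraMap A Q (a i) = q) ∧
      (∀ q, ∑ i, Algebra.trace F Q (q * algebraMap A Q (a i)) • y i = q) := by
  have := h.finite
  have := h.torsionFree
  have := finiteDimensional_of_finite R F A Q
  have := projective_of_finite_of_isTorsionFree R A
  obtain ⟨n, ⟨c⟩⟩ := ProjectiveCoordinates.exists_of_projective R A
  have hε := isBaseChange_of_finite R F A Q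
  let y (i : Fin n) : Q := ((Algebra.traceForm F Q).toDual h.etale).symm ((c.baseChange hε).coord i)
  have hy (i : Fin n) (q : Q) : Algebra.trace F Q (y i * q) = (c.baseChange hε).coord i q :=
    LinearMap.BilinForm.apply_toDual_symm_apply (hB := h.etale) _ q
  have hsum (q : Q) : ∑ i, Algebra.trace F Q (y i * q) • algebraMap A Q (c.vec i) = q := by
    simp only [hy]
    exact (c.baseChange hε).sum_coord_smul q
  refine ⟨n, c.vec, y, fun i a ↦ ?_, hsum, fun q ↦ ?_⟩
  · rw [hy]
    exact ⟨c.coord i a, Submodule.mem_top, (hε.toDual_comp_apply _ a).symm⟩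
  · refine sub_eq_zero.mp (h.etale.1 _ fun z ↦ ?_)
    rw [map_sub, LinearMap.sub_apply, sub_eq_zero]
    conv_rhs => rw [← hsum z]
    simp [mul_comm]

theorem idealExtension_mul_traceColon_top (h : IsTraceOrder R F A Q) (I : Ideal R) :
    idealExtension A Q I * traceColon F A Q (⊤ : Ideal R) = traceColon F A Q I := by
  refine le_antisymm (idealExtension_mul_le.mpr fun r hr x hx a ↦ ?_) fun q hq ↦ ?_
  · obtain ⟨t, -, ht⟩ := hx a
    refine ⟨r * t, I.mul_mem_right t hr, ?_⟩
    rw [smul_mul_assoc, ← algebraMap_smul F r, map_smul, smul_eq_mul, ← ht]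
    exact map_mul (algebraMap R F) r t
  · obtain ⟨n, a, y, hy, -, hq'⟩ := h.exists_dual_family
    rw [← hq' q]
    refine sum_mem fun i _ ↦ ?_
    obtain ⟨t, htI, ht⟩ := hq (a i)
    rw [← ht, Algebra.linearMap_apply, algebraMap_smul]
    exact smul_mem_idealExtension_mul htI (hy i)

theorem traceColon_top_div_self_le_one (h : IsTraceOrder R F A Q) :
    traceColon F A Q (⊤ : Ideal R) / traceColon F A Q (⊤ : Ideal R) ≤ 1 := by
  intro x hx
  obtain ⟨n, a, y, hy, hx', -⟩ := h.exists_dual_family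
  rw [← hx' x]
  refine sum_mem fun i _ ↦ ?_
  obtain ⟨t, -, ht⟩ := trace_mem_of_mem_traceColon (mul_comm x (y i) ▸
    Submodule.mem_div_iff_forall_mul_mem.mp hx (y i) (hy i))
  rw [← ht, Algebra.linearMap_apply, algebraMap_smul]
  exact Submodule.smul_of_tower_mem _ t (Submodule.algebraMap_mem (a i))

theorem exists_smul_traceColon_top_le_one (h : IsTraceOrder R F A Q) :
    ∃ r : R, r ≠ 0 ∧ r • traceColon F A Q (⊤ : Ideal R) ≤ 1 := by
  have := h.finite
  have := h.torsionFree
  have := isLocalizedModule_of_finite R A Q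
  obtain ⟨n, a, y, -, -, hd⟩ := h.exists_dual_family
  obtain ⟨r, hr⟩ := IsLocalizedModule.exist_integer_multiples_of_finite R⁰
    (IsScalarTower.toAlgHom R A Q).toLinearMap y
  refine ⟨r, nonZeroDivisors.ne_zero r.2, ?_⟩
  rintro _ ⟨d, hdD, rfl⟩
  rw [DistribSMul.toLinearMap_apply, ← hd d, Finset.smul_sum]
  refine sum_mem fun i _ ↦ ?_
  obtain ⟨t, -, ht⟩ := hdD (a i)
  rw [← ht, Algebra.linearMap_apply, algebraMap_smul, smul_comm]
  obtain ⟨b, hb⟩ := hr i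
  exact Submodule.smul_of_tower_mem _ t (Submodule.mem_one.mpr ⟨b, hb⟩)

theorem integralClosure_le_traceColon_top (h : IsTraceOrder R F A Q) :
    Subalgebra.toSubmodule (integralClosure A Q) ≤ traceColon F A Q (⊤ : Ideal R) := by
  have := h.finite
  have := h.torsionFree
  have := finiteDimensional_of_finite R F A Q
  intro x hx a
  obtain ⟨t, ht⟩ := trace_mem_range_algebraMap_of_isIntegral (F := F)
    (isIntegral_trans (R := R) _ (IsIntegral.mul hx (isIntegral_algebraMap (x := a))))
  exact ⟨t, Submodule.mem_top, ht⟩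

theorem traceColon_inf_one (h : IsTraceOrder R F A Q) {P : Ideal R} [P.IsMaximal]
    (hP : ringChar (R ⧸ P) = 0 ∨ Module.finrank F Q < ringChar (R ⧸ P)) :
    traceColon F A Q P ⊓ 1 = coeSubmodule Q (P.map (algebraMap R A)).radical := by
  have := h.finite
  have := h.torsionFree
  have := finiteDimensional_of_finite R F A Q
  have := projective_of_finite_of_isTorsionFree R A
  have hε := isBaseChange_of_finite R F A Q
  obtain ⟨n, ⟨c⟩⟩ := ProjectiveCoordinates.exists_of_projective R A
  have htrace (b : A) : Algebra.trace F Q (algebraMap A Q b) =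
      algebraMap R F (c.trace (Algebra.lmul R A b)) :=
    c.linearMapTrace_eq_algebraMap hε fun x ↦ (map_mul (algebraMap A Q) b x).symm
  have hmem (x : A) : algebraMap A Q x ∈ traceColon F A Q P ↔
      x ∈ (P.map (algebraMap R A)).radical := by
    rw [c.mem_radical_map_iff (finrank_eq_of_isBaseChange hε ▸ hP), mem_traceColon]
    refine forall_congr' fun a ↦ ?_
    rw [← map_mul, htrace]
    exact (IsFractionRing.injective R F).mem_set_image
  refine le_antisymm ?_ ?_
  · rintro _ ⟨hq, hq1⟩
    obtain ⟨x, rfl⟩ := Submodule.mem_one.mp hq1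
    exact ⟨x, (hmem x).mp hq, rfl⟩
  · rintro _ ⟨x, hx, rfl⟩
    exact ⟨(hmem x).mpr hx, Submodule.algebraMap_mem x⟩

end IsTraceOrder
end TraceColon

section LocalCriterion
variable {R F A Q : Type*} [CommRing R] [IsDedekindDomain R] [Field F] [CommRing A] [CommRing Q]
  [Algebra R F] [IsFractionRing R F] [Algebra R A] [Algebra A Q] [Algebra R Q]
  [Algebra F Q] [IsScalarTower R A Q] [IsScalarTower R F Q] {P : Ideal R}

namespace IsTraceOrder

theorem radical_div_self_le_integralClosure (h : IsTraceOrder R F A Q) (hP0 : P ≠ ⊥) :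
    coeSubmodule Q (P.map (algebraMap R A)).radical /
      coeSubmodule Q (P.map (algebraMap R A)).radical ≤
        Subalgebra.toSubmodule (integralClosure A Q) := by
  have := h.finite
  have : IsNoetherianRing A := IsNoetherianRing.of_finite R A
  obtain ⟨t, htP, ht0⟩ := Submodule.exists_mem_ne_zero_of_ne_bot hP0
  have hunit : IsUnit (algebraMap R Q t) := by
    rw [IsScalarTower.algebraMap_apply R F Q]
    exact (IsUnit.mk0 _ (by simpa using ht0)).map _
  refine div_self_le_integralClosure ((IsNoetherian.noetherian _).map _)
    ⟨algebraMap R A t, Ideal.le_radical (Ideal.mem_map_of_mem _ htP), ?_⟩ hunit.isRegular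
  exact (IsScalarTower.algebraMap_apply R A Q t).symm

variable [IsFractionRing A Q]

theorem exists_locallyLE_radical_pow_mul_traceColon_top (h : IsTraceOrder R F A Q) [P.IsPrime]
    (hP0 : P ≠ ⊥) : ∃ m, LocallyLE P
      (coeSubmodule Q (P.map (algebraMap R A)).radical ^ m * traceColon F A Q (⊤ : Ideal R)) 1 := by
  have := h.finite
  have : IsNoetherianRing A := IsNoetherianRing.of_finite R A
  obtain ⟨r, hr, hrD⟩ := h.exists_smul_traceColon_top_le_one
  obtain ⟨e, -, hdvd⟩ := exists_notMem_pow_dvd hP0 hr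
  obtain ⟨k, hk⟩ := (P.map (algebraMap R A)).exists_radical_pow_le_of_fg
    (IsNoetherian.noetherian _)
  have hJ : coeSubmodule Q (P.map (algebraMap R A)).radical ^ (k * e) ≤
      idealExtension A Q (P ^ e) := by
    rw [idealExtension_pow, pow_mul]
    refine pow_le_pow_left' ?_ e
    calc coeSubmodule Q (P.map (algebraMap R A)).radical ^ k
        = coeSubmodule Q ((P.map (algebraMap R A)).radical ^ k) :=
          (map_pow (Submodule.mapHom (Algebra.ofId A Q)) _ k).symm
      _ ≤ idealExtension A Q P := IsLocalization.coeSubmodule_mono Q hk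
  exact ⟨k * e, ((LocallyLE.idealExtension_mul hdvd).mono_right hrD).mono_left
    (mul_le_mul_left hJ _)⟩

section
variable (h : IsTraceOrder R F A Q) [P.IsMaximal] (hP0 : P ≠ ⊥)
  (hP : ringChar (R ⧸ P) = 0 ∨ Module.finrank F Q < ringChar (R ⧸ P))
include h hP0 hP

theorem locallyLE_traceColon_of_locallyLE_integralClosure
    (hC : LocallyLE P (Subalgebra.toSubmodule (integralClosure A Q)) 1) :
    LocallyLE P (traceColon F A Q P) 1 := by
  have hT : traceColon F A Q P ≤ traceColon F A Q (⊤ : Ideal R) :=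
    fun x hx a ↦ IsLocalization.coeSubmodule_mono F le_top (hx a)
  obtain ⟨m, hm⟩ := h.exists_locallyLE_radical_pow_mul_traceColon_top hP0
  refine LocallyLE.of_pow_mul (coeSubmodule_le_one _) ?_
    (hC.mono_left (h.radical_div_self_le_integralClosure hP0))
    (hm.mono_left (mul_le_mul_right hT _))
  rw [← h.traceColon_inf_one hP]
  exact inf_le_inf_right 1 (mul_le_of_le_one_left' inf_le_right)

/-- By the hypothesis `P A†` equals the radical `J` of `P A` locally at `P`, so that multipliers of
`J` are multipliers of `A†`. -/
theorem locallyLE_radical_div_self (hT : LocallyLE P (traceColon F A Q P) 1) :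
    LocallyLE P (coeSubmodule Q (P.map (algebraMap R A)).radical /
      coeSubmodule Q (P.map (algebraMap R A)).radical) 1 := by
  have : Module.IsTorsionFree R Q := .trans_faithfulSMul R F Q
  set J := coeSubmodule Q (P.map (algebraMap R A)).radical
  set D := traceColon F A Q (⊤ : Ideal R)
  have hJ : traceColon F A Q P ⊓ 1 = J := h.traceColon_inf_one hP
  have hTJ : LocallyLE P (traceColon F A Q P) J := hJ ▸ hT.inf_of_le le_rfl
  have hJT : J / J * J ≤ traceColon F A Q P :=
    (Submodule.le_div_iff_mul_le.mp le_rfl).trans (inf_le_left.trans' hJ.ge)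
  have hmul := (hTJ.mul_left (J / J)).mono_right hJT
  rw [← h.idealExtension_mul_traceColon_top, mul_left_comm] at hmul
  exact (LocallyLE.mul_left_iff_le_div.mp (hmul.of_idealExtension_mul hP0)).mono_right
    h.traceColon_top_div_self_le_one

theorem locallyLE_integralClosure_of_locallyLE_traceColon
    (hT : LocallyLE P (traceColon F A Q P) 1) :
    LocallyLE P (Subalgebra.toSubmodule (integralClosure A Q)) 1 := by
  obtain ⟨m, hm⟩ := h.exists_locallyLE_radical_pow_mul_traceColon_top hP0
  refine LocallyLE.of_pow_mul (coeSubmodule_le_one _) ?_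
    (h.locallyLE_radical_div_self hP0 hP hT)
    (hm.mono_left (mul_le_mul_right h.integralClosure_le_traceColon_top _))
  conv_rhs => rw [← Ideal.radical_idem]
  exact coeSubmodule_mul_integralClosure_inf_one_le (IsFractionRing.injective A Q) _

end
end IsTraceOrder
end LocalCriterion

section Annihilator

theorem mem_annihilator_quotient_submoduleOf_iff {R M : Type*} [CommRing R] [AddCommGroup M]
    [Module R M] {N L : Submodule R M} {r : R} :
    r ∈ Module.annihilator R (L ⧸ N.submoduleOf L) ↔ ∀ x ∈ L, r • x ∈ N := by
  rw [Module.mem_annihilator, (Submodule.Quotient.mk_surjective _).forall]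
  simp only [← Submodule.Quotient.mk_smul, Submodule.Quotient.mk_eq_zero]
  exact Subtype.forall

section
variable {R A Q : Type*} [CommRing R] [CommRing A] [CommRing Q] [Algebra R A] [Algebra A Q]
  [Algebra R Q] [IsScalarTower R A Q] {P : Ideal R}

theorem orderSubmodule_eq_restrictScalars_one :
    orderSubmodule R A Q = (1 : Submodule A Q).restrictScalars R := by
  ext x
  rw [Submodule.restrictScalars_mem, Submodule.mem_one]
  rfl

theorem not_dvd_annihilator_closureQuotient_iff [IsDedekindDomain R] :
    ¬ P ∣ Module.annihilator R (ClosureQuotient R A Q) ↔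
      LocallyLE P (Subalgebra.toSubmodule (integralClosure A Q)) 1 := by
  rw [Ideal.dvd_iff_le, SetLike.not_le_iff_exists]
  simp only [mem_annihilator_quotient_submoduleOf_iff, orderSubmodule_eq_restrictScalars_one]
  exact exists_congr fun s ↦ and_comm

variable {F : Type*} [Field F] [Algebra R F] [Algebra F Q] [IsScalarTower R F Q]

theorem traceDualSubmodule_eq_restrictScalars_traceColon :
    traceDualSubmodule R F A Q = (traceColon F A Q (⊤ : Ideal R)).restrictScalars R := by
  ext x
  rw [traceDualSubmodule, LinearMap.BilinForm.mem_dualSubmodule, Submodule.restrictScalars_mem,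
    mem_traceColon, IsLocalization.coeSubmodule_top]
  exact Set.forall_mem_range

theorem not_sq_dvd_annihilator_dualQuotient_iff [IsDedekindDomain R] [P.IsPrime] (hP0 : P ≠ ⊥) :
    ¬ P ^ 2 ∣ Module.annihilator R (DualQuotient R F A Q) ↔
      LocallyLE P (idealExtension A Q P * traceColon F A Q (⊤ : Ideal R)) 1 := by
  rw [Ideal.dvd_iff_le, SetLike.not_le_iff_exists]
  simp only [mem_annihilator_quotient_submoduleOf_iff, orderSubmodule_eq_restrictScalars_one,
    traceDualSubmodule_eq_restrictScalars_traceColon, Submodule.restrictScalars_mem]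
  constructor
  · rintro ⟨t, htD, ht⟩
    refine (LocallyLE.idealExtension_mul
      (exists_notMem_dvd_of_notMem_sq hP0 ht)).mono_right ?_
    rintro _ ⟨x, hx, rfl⟩
    exact htD x hx
  · rintro ⟨s, hs, hsD⟩
    obtain ⟨t, htP, ht⟩ := exists_mem_notMem_sq hP0
    refine ⟨t * s, fun x hx ↦ ?_, fun hts ↦ hs (Ideal.mem_prime_of_mul_mem_pow hP0 ht hts)⟩
    rw [mul_comm, mul_smul]
    exact hsD _ (smul_mem_idealExtension_mul htP hx)

end

theorem IsTraceOrder.dvd_annihilator_closureQuotient_iff {R F A Q : Type*} [CommRing R]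
    [IsDedekindDomain R] [Field F] [CommRing A] [CommRing Q] [Algebra R F] [IsFractionRing R F]
    [Algebra R A] [Algebra A Q] [IsFractionRing A Q] [Algebra R Q] [Algebra F Q]
    [IsScalarTower R A Q] [IsScalarTower R F Q] (h : IsTraceOrder R F A Q) {P : Ideal R}
    [hPp : P.IsPrime] (hP0 : P ≠ ⊥)
    (hP : ringChar (R ⧸ P) = 0 ∨ Module.finrank F Q < ringChar (R ⧸ P)) :
    P ∣ Module.annihilator R (ClosureQuotient R A Q) ↔
      P ^ 2 ∣ Module.annihilator R (DualQuotient R F A Q) := by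
  have : P.IsMaximal := hPp.isMaximal hP0
  rw [← not_iff_not, not_dvd_annihilator_closureQuotient_iff,
    not_sq_dvd_annihilator_dualQuotient_iff hP0, h.idealExtension_mul_traceColon_top]
  exact ⟨h.locallyLE_traceColon_of_locallyLE_integralClosure hP0 hP,
    h.locallyLE_integralClosure_of_locallyLE_traceColon hP0 hP⟩

theorem span_natCast_dvd_annihilator_iff {M : Type*} [AddCommGroup M] {n : ℕ} :
    Ideal.span {(n : ℤ)} ∣ Module.annihilator ℤ M ↔ n ∣ AddMonoid.exponent M := by
  suffices h : Module.annihilator ℤ M = Ideal.span {(AddMonoid.exponent M : ℤ)} by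
    rw [h, Ideal.dvd_iff_le, Ideal.span_singleton_le_span_singleton, Int.natCast_dvd_natCast]
  ext z
  rw [Module.mem_annihilator, Ideal.mem_span_singleton,
    AddGroup.exponent_dvd_iff_forall_zsmul_eq_zero]

end Annihilator

section NumberField
variable {K : Type*} [Field K]

theorem isFractionRing_adjoin_int [CharZero K] {α : K}
    (hα : IntermediateField.adjoin ℚ {α} = ⊤) : IsFractionRing (Algebra.adjoin ℤ {α}) K := by
  let L : IntermediateField ℚ K :=
    (Subfield.closure {α}).toIntermediateField fun q ↦ by simp
  have hL : IntermediateField.adjoin ℚ {α} ≤ L :=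
    IntermediateField.adjoin_le_iff.mpr Subfield.subset_closure
  refine IsFractionRing.of_field _ _ fun z ↦ ?_
  have hz : z ∈ L := hL (hα ▸ IntermediateField.mem_top)
  obtain ⟨x, hx, y, hy, hxy⟩ := Subfield.mem_closure_iff.mp hz
  have hle : Subring.closure {α} ≤ (Algebra.adjoin ℤ {α}).toSubring :=
    Subring.closure_le.mpr Algebra.subset_adjoin
  exact ⟨⟨x, hle hx⟩, ⟨y, hle hy⟩, hxy.symm⟩

theorem isTraceOrder_adjoin_int [NumberField K] {α : K} (hα : IsIntegral ℤ α) :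
    IsTraceOrder ℤ ℚ (Algebra.adjoin ℤ {α}) K where
  finite := Module.Finite.iff_fg.mpr hα.fg_adjoin_singleton
  torsionFree := inferInstance
  etale := traceForm_nondegenerate ℚ K

theorem ringChar_quotient_span_natCast (n : ℕ) : ringChar (ℤ ⧸ Ideal.span {(n : ℤ)}) = n :=
  ringChar.eq_iff.mpr
    (charP_of_injective_ringHom (f := (Int.quotientSpanNatEquivZMod n).symm.toRingHom)
      (Int.quotientSpanNatEquivZMod n).symm.injective n)

end NumberField

theorem theorem1 :
    -- the order `A = ℤ[α]` in the number field `K = ℚ(α)`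
    (∀ (K : Type*) [Field K] [NumberField K] (α : K),
      IsIntegral ℤ α → IntermediateField.adjoin ℚ {α} = ⊤ →
      ∀ p : ℕ, p.Prime → Module.finrank ℚ K < p →
        (p ∣ AddMonoid.exponent (ClosureQuotient ℤ (Algebra.adjoin ℤ {α}) K) ↔
          p ^ 2 ∣ AddMonoid.exponent (DualQuotient ℤ ℚ (Algebra.adjoin ℤ {α}) K))) ∧
    -- an arbitrary order `A` over a Dedekind domain `R`
    (∀ (R F A Q : Type*) [CommRing R] [IsDedekindDomain R] [Field F] [CommRing A] [CommRing Q]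
      [Algebra R F] [IsFractionRing R F] [Algebra R A] [Algebra A Q] [IsFractionRing A Q]
      [Algebra R Q] [Algebra F Q] [IsScalarTower R A Q] [IsScalarTower R F Q],
      IsTraceOrder R F A Q →
      ∀ P : Ideal R, P.IsPrime → P ≠ ⊥ →
        (ringChar (R ⧸ P) = 0 ∨ Module.finrank F Q < ringChar (R ⧸ P)) →
        (P ∣ Module.annihilator R (ClosureQuotient R A Q) ↔
          P ^ 2 ∣ Module.annihilator R (DualQuotient R F A Q))) := by
  refine ⟨fun K _ _ α hα hK p hp hlt ↦ ?_,
    fun R F A Q _ _ _ _ _ _ _ _ _ _ _ _ _ _ h P hP hP0 hchar ↦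
      h.dvd_annihilator_closureQuotient_iff hP0 hchar⟩
  have := isFractionRing_adjoin_int hK
  have hp0 : (p : ℤ) ≠ 0 := Nat.cast_ne_zero.mpr hp.ne_zero
  have : (Ideal.span {(p : ℤ)}).IsPrime :=
    (Ideal.span_singleton_prime hp0).mpr (Nat.prime_iff_prime_int.mp hp)
  rw [← span_natCast_dvd_annihilator_iff, ← span_natCast_dvd_annihilator_iff, Nat.cast_pow,
    ← Ideal.span_singleton_pow]
  exact (isTraceOrder_adjoin_int hα).dvd_annihilator_closureQuotient_iff
    (mt Ideal.span_singleton_eq_bot.mp hp0)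
    (Or.inr ((ringChar_quotient_span_natCast p).symm ▸ hlt))
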